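/- Let $T'$ be a tree on $n$ nodes and let $T'_1,\dots,T'_n$ be a family of $n$ non-empty subtrees of $T'$ (repetitions allowed). Let $G$ be their vertex-intersection graph: its vertices are $1,\dots,n$, and distinct $i,i'$ are adjacent if and only if $T'_i$ and $T'_{i'}$ have a common node. (The graphs with such a representation are chordal, i.e. have no induced cycle of length at least $4$.) Let $m$ be the number of edges of $G$. Then the maximum possible total size $\sum_{i=1}^n |V(T'_i)|$ is of order $m\sqrt n$, in the following sense. 1. For every such representation, $$\sum_{i=1}^n |V(T'_i)| \;\le\; \frac83\sqrt{\frac{2n}{3}}\,(2m+n).$$ 2. There is an absolute constant $C>0$ such that, for every such representation, $$\sum_{i=1}^n |V(T'_i)| \;\le\; C\,m\sqrt n+n .$$ In particular, the sum is at most $(C+1)\,m\sqrt n$ whenever $m\ge\sqrt n$. 3. There is an absolute constant $c>0$ such that, for every $n\ge 3$, there is a chordal graph $G$ with $n$ vertices and $m\ge n$ edges that has such a representation, on a tree with $n$ nodes, with $$\sum_{i=1}^n |V(T'_i)| \;\ge\; c\,(2m+n)\sqrt n \;\ge\; c\,m\sqrt n .$$ -/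

import Mathlib

/-- A graph is chordal if it contains no induced cycle of length four or more. -/
def SimpleGraph.IsChordalGraph {V : Type*} (G : SimpleGraph V) : Prop :=
  ∀ k : ℕ, 4 ≤ k → IsEmpty (SimpleGraph.cycleGraph k ↪g G)

/-- The vertex-intersection graph of an indexed family of subgraphs: two distinct indices are
adjacent if and only if the corresponding subgraphs have a common node. -/
def subgraphIntersectionGraph {V W : Type*} {T : SimpleGraph W} (S : V → T.Subgraph) :
    SimpleGraph V where
  Adj u v := u ≠ v ∧ ((S u).verts ∩ (S v).verts).Nonempty
  symm := ⟨fun _ _ h => ⟨h.1.symm, by rw [Set.inter_comm]; exact h.2⟩⟩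
  loopless := ⟨fun _ h => h.1 rfl⟩

/-- A subtree intersection representation of the graph `G` on the tree `T`: a family of
(nonempty) subtrees of `T`, indexed by the vertices of `G`, repetitions allowed, whose
vertex-intersection graph is `G`. -/
structure SubtreeRepresentation {V W : Type*} (G : SimpleGraph V) (T : SimpleGraph W) where
  /-- The host graph is a tree. -/
  isTree : T.IsTree
  /-- The subgraph of the host tree that represents a vertex. -/
  subtree : V → T.Subgraph
  /-- Each of these subgraphs is a tree. -/
  isTree_subtree : ∀ v, (subtree v).coe.IsTree
  /-- The represented graph is the intersection graph. -/
  intersectionGraph_eq : subgraphIntersectionGraph subtree = G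

/-- The size of a representation: the total number of nodes of its subtrees. -/
noncomputable def SubtreeRepresentation.size {V W : Type*} [Fintype V] {G : SimpleGraph V}
    {T : SimpleGraph W} (R : SubtreeRepresentation G T) : ℕ :=
  ∑ v, (R.subtree v).verts.ncard

/-! Upper bound: count incidences by node. The `k` subtrees through a node form a clique, so `k * (k
- 1) ≤ 2 * m` and `k ≤ 1 + √(2 * m)`. Only the set `U` of nodes with load above 1 contributes an
excess over `n`. Trivially `#U ≤ n`, and `card_multiply_covered_le` gives `#U ≤ 2 * m`, hence `#U ≤
√n * √(2 * m)` and the excess is at most `2 * m * √n`.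

Lower bound: on a star, about `√n` copies of one subtree with about half of the nodes cost only O(n)
edges. The other vertices share single leaves in pairs, adding at most `n / 2` edges. -/

open Finset

/-! ### Families of nonempty finite sets -/

section Families

variable {V W : Type*} [Fintype V] {G : SimpleGraph V} {S : V → Finset W}

/-- The degrees of a finite graph add up to twice the number of its edges. -/
theorem SimpleGraph.sum_degrees_eq_twice_ncard_edgeSet (G : SimpleGraph V) [DecidableRel G.Adj] :
    ∑ v, G.degree v = 2 * G.edgeSet.ncard := by
  classical
  rw [G.sum_degrees_eq_twice_card_edges, Set.ncard_eq_toFinset_card', SimpleGraph.edgeFinset]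

/-- The members of a family that contain a given point form a clique of the intersection graph. -/
theorem load_mul_load_sub_one_le [DecidableEq W]
    (hG : ∀ u v, u ≠ v → (S u ∩ S v).Nonempty → G.Adj u v) (w : W) :
    #{v | w ∈ S v} * (#{v | w ∈ S v} - 1) ≤ 2 * G.edgeSet.ncard := by
  classical
  rw [← G.sum_degrees_eq_twice_ncard_edgeSet]
  calc #{v | w ∈ S v} * (#{v | w ∈ S v} - 1)
      = ∑ v ∈ ({v | w ∈ S v} : Finset V), (#{v | w ∈ S v} - 1) := by simp
    _ ≤ ∑ v ∈ ({v | w ∈ S v} : Finset V), G.degree v := by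
      refine sum_le_sum fun v hv ↦ ?_
      rw [← card_erase_of_mem hv, ← G.card_neighborFinset_eq_degree]
      refine card_le_card fun u hu ↦ ?_
      simp only [mem_erase, mem_filter, mem_univ, true_and] at hu hv
      rw [SimpleGraph.mem_neighborFinset]
      exact hG v u hu.1.symm ⟨w, mem_inter.2 ⟨hv, hu.2⟩⟩
    _ ≤ ∑ v, G.degree v := sum_le_sum_of_subset (subset_univ _)

/-- If the family has at least as many members as there are points, the number of points that
lie in more than one member is at most twice the number of edges of the intersection graph. -/
theorem card_multiply_covered_le [Fintype W] [DecidableEq W]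
    (hG : ∀ u v, u ≠ v → (S u ∩ S v).Nonempty → G.Adj u v) (hS : ∀ v, (S v).Nonempty)
    (hcard : Fintype.card W ≤ Fintype.card V) :
    #{w | 1 < #{v | w ∈ S v}} ≤ 2 * G.edgeSet.ncard := by
  classical
  choose f hf using hS
  -- An isolated vertex owns its chosen point alone. These points are distinct and avoid the
  -- multiply covered ones, which are thus at most as many as the non-isolated vertices.
  set I : Finset V := {v | G.degree v = 0} with hI
  have hiso : ∀ u ∈ I, ∀ v, u ≠ v → ∀ w ∈ S u, w ∉ S v := by
    intro u hu v huv w hwu hwv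
    have hadj := hG u v huv ⟨w, mem_inter.2 ⟨hwu, hwv⟩⟩
    have := (G.degree_pos_iff_exists_adj u).2 ⟨v, hadj⟩
    simp only [hI, mem_filter, mem_univ, true_and] at hu
    omega
  have hinj : Set.InjOn f I := by
    intro u hu v hv huv
    by_contra hne
    exact hiso u hu v hne (f u) (hf u) (huv ▸ hf v)
  have hdisj : Disjoint ({w | 1 < #{v | w ∈ S v}} : Finset W) (I.image f) := by
    rw [disjoint_right]
    intro w hw hw'
    obtain ⟨u, hu, rfl⟩ := mem_image.1 hw
    simp only [mem_filter, mem_univ, true_and] at hw'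
    obtain ⟨v, hv, hvu⟩ := exists_mem_ne hw' u
    exact hiso u hu v hvu.symm (f u) (hf u) (by simpa using hv)
  have h₁ : #{w | 1 < #{v | w ∈ S v}} + #I ≤ Fintype.card W := by
    rw [← card_image_of_injOn hinj, ← card_union_of_disjoint hdisj]
    exact card_le_univ _
  have h₂ : #Iᶜ ≤ 2 * G.edgeSet.ncard := by
    rw [← G.sum_degrees_eq_twice_ncard_edgeSet, card_eq_sum_ones]
    refine (sum_le_sum fun v hv ↦ ?_).trans (sum_le_sum_of_subset (subset_univ Iᶜ))
    simp only [hI, mem_compl, mem_filter, mem_univ, true_and] at hv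
    omega
  have h₃ := card_add_card_compl I
  omega

/-- The total size of a family of `n` nonempty subsets of an `n`-element set whose intersection
graph has `m` edges is at most `2 * m * √n + n`. -/
theorem sum_card_le_of_intersectionGraph [Fintype W] [DecidableEq W]
    (hG : ∀ u v, u ≠ v → (S u ∩ S v).Nonempty → G.Adj u v) (hS : ∀ v, (S v).Nonempty)
    (hcard : Fintype.card W = Fintype.card V) :
    ((∑ v, #(S v) : ℕ) : ℝ) ≤
      2 * ((G.edgeSet.ncard : ℝ) * √(Fintype.card V : ℝ)) + (Fintype.card V : ℝ) := by
  classical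
  set n := Fintype.card V
  set m := G.edgeSet.ncard
  set U : Finset W := {w | 1 < #{v | w ∈ S v}} with hU
  have hswap : ∑ v, #(S v) = ∑ w, #{v | w ∈ S v} := by
    simpa [bipartiteAbove, bipartiteBelow] using
      sum_card_bipartiteAbove_eq_sum_card_bipartiteBelow (s := (univ : Finset V))
        (t := (univ : Finset W)) (fun v w ↦ w ∈ S v)
  have hload : ∀ w, (#{v | w ∈ S v} : ℝ) ≤ 1 + if w ∈ U then √(2 * m : ℝ) else 0 := by
    intro w
    by_cases hw : w ∈ U
    · have hclique := load_mul_load_sub_one_le hG w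
      have h1 : 1 < #{v | w ∈ S v} := by simpa [hU] using hw
      rw [if_pos hw]
      generalize #{v | w ∈ S v} = k at *
      obtain ⟨k, rfl⟩ : ∃ j, k = j + 1 := ⟨k - 1, by omega⟩
      -- With load `k + 1`, the clique bound reads `(k + 1) * k ≤ 2 * m`.
      have : (k : ℝ) ≤ √(2 * m : ℝ) := by
        refine Real.le_sqrt_of_sq_le ?_
        have : k ^ 2 ≤ 2 * m := le_trans (by rw [Nat.add_sub_cancel]; nlinarith) hclique
        exact_mod_cast this
      push_cast
      linarith
    · have h1 : #{v | w ∈ S v} ≤ 1 := by simpa [hU] using hw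
      rw [if_neg hw, add_zero]
      exact_mod_cast h1
  have hUn : (#U : ℝ) ≤ n := by
    have := card_le_univ U
    rw [hcard] at this
    exact_mod_cast this
  have hUm : (#U : ℝ) ≤ 2 * m := by
    exact_mod_cast card_multiply_covered_le hG hS hcard.le
  have hUs : (#U : ℝ) ≤ √(n : ℝ) * √(2 * m : ℝ) := by
    rw [← Real.sqrt_mul (Nat.cast_nonneg n)]
    refine Real.le_sqrt_of_sq_le ?_
    rw [sq]
    exact mul_le_mul hUn hUm (Nat.cast_nonneg _) (Nat.cast_nonneg _)
  have hsq : √(2 * m : ℝ) * √(2 * m : ℝ) = 2 * m := Real.mul_self_sqrt (by positivity)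
  calc ((∑ v, #(S v) : ℕ) : ℝ) = ∑ w, (#{v | w ∈ S v} : ℝ) := by rw [hswap]; push_cast; rfl
    _ ≤ ∑ w, (1 + if w ∈ U then √(2 * m : ℝ) else 0) := sum_le_sum fun w _ ↦ hload w
    _ = n + #U * √(2 * m : ℝ) := by
      rw [sum_add_distrib, sum_ite_mem, univ_inter, sum_const, sum_const, card_univ, hcard]
      simp [n]
    _ ≤ n + √(n : ℝ) * √(2 * m : ℝ) * √(2 * m : ℝ) := by gcongr
    _ = 2 * ((m : ℝ) * √(n : ℝ)) + n := by rw [mul_assoc, hsq]; ring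

end Families

/-- The total size of a subtree representation, with as many nodes as vertices, of a graph with
`n` vertices and `m` edges is at most `2 * m * √n + n`. -/
theorem SubtreeRepresentation.size_le {V W : Type*} [Fintype V] [Fintype W] {G : SimpleGraph V}
    {T : SimpleGraph W} (R : SubtreeRepresentation G T)
    (hcard : Fintype.card W = Fintype.card V) :
    (R.size : ℝ) ≤
      2 * ((G.edgeSet.ncard : ℝ) * √(Fintype.card V : ℝ)) + (Fintype.card V : ℝ) := by
  classical
  have h := sum_card_le_of_intersectionGraph (G := G) (S := fun v ↦ (R.subtree v).verts.toFinset)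
    (fun u v huv hne ↦ by
      rw [← R.intersectionGraph_eq]
      refine ⟨huv, ?_⟩
      rwa [← Set.toFinset_inter, Set.toFinset_nonempty] at hne)
    (fun v ↦ by
      obtain ⟨w⟩ := (R.isTree_subtree v).connected.nonempty
      exact ⟨w, by simp⟩) hcard
  simpa only [SubtreeRepresentation.size, Set.ncard_eq_toFinset_card'] using h

/-! ### Intersection graphs of subtrees of a star -/

/-- A graph in which adjacency means having the same label is chordal. -/
theorem SimpleGraph.isChordalGraph_of_adj_iff {V α : Type*} {G : SimpleGraph V} (f : V → α)
    (hG : ∀ u v, G.Adj u v ↔ u ≠ v ∧ f u = f v) : G.IsChordalGraph := by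
  intro k hk
  refine ⟨fun e ↦ ?_⟩
  obtain ⟨j, rfl⟩ : ∃ j, k = j + 4 := ⟨k - 4, by omega⟩
  have h2 : ((2 : Fin (j + 4)) : ℕ) = 2 := Nat.mod_eq_of_lt (show 2 < j + 4 by omega)
  have h1 : ((1 : Fin (j + 4)) : ℕ) = 1 := Nat.mod_eq_of_lt (show 1 < j + 4 by omega)
  have hlt : j + 4 - 2 < j + 4 := by omega
  -- Equal labels are transitive: the path 0, 1, 2 forces the chord from 0 to 2.
  have h01 : (cycleGraph (j + 4)).Adj 0 1 := by simp [cycleGraph_adj]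
  have h12 : (cycleGraph (j + 4)).Adj 1 2 := by
    rw [cycleGraph_adj]
    right
    rw [Fin.ext_iff, Fin.sub_def, h1, h2]
    change (j + 4 - 1 + 2) % (j + 4) = 1
    rw [show j + 4 - 1 + 2 = 1 + (j + 4) by omega, Nat.add_mod_right, Nat.mod_eq_of_lt (by omega)]
  have h02 : ¬ (cycleGraph (j + 4)).Adj 0 2 := by
    rw [cycleGraph_adj, Fin.ext_iff, Fin.ext_iff, Fin.sub_def, Fin.sub_def, h1, h2, Fin.val_zero]
    change ¬ ((j + 4 - 2 + 0) % (j + 4) = 1 ∨ (j + 4 - 0 + 2) % (j + 4) = 1)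
    rw [add_zero, Nat.mod_eq_of_lt hlt, Nat.sub_zero, Nat.add_mod_left, Nat.mod_eq_of_lt (by omega)]
    omega
  rw [← e.map_adj_iff, hG] at h01 h12 h02
  refine h02 ⟨e.injective.ne ?_, h01.2.trans h12.2⟩
  rw [ne_eq, Fin.ext_iff, h2, Fin.val_zero]
  omega

/-- A set of vertices of a star that contains the center or is a singleton induces a subtree. -/
theorem SimpleGraph.isTree_coe_induce_starGraph {W : Type*} {r : W} {s : Set W}
    (hs : r ∈ s ∨ ∃ c, s = {c}) : ((⊤ : (starGraph r).Subgraph).induce s).coe.IsTree := by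
  -- A vertex adjacent to all others gives connectedness; acyclicity is inherited from the star.
  obtain ⟨c, hc, hadj⟩ : ∃ c ∈ s, ∀ x ∈ s, c ≠ x → (starGraph r).Adj c x := by
    rcases hs with hr | ⟨c, rfl⟩
    · exact ⟨r, hr, fun x _ hx ↦ starGraph_center_adj hx⟩
    · exact ⟨c, rfl, fun x hx hne ↦ (hne hx.symm).elim⟩
  have hconn : ((⊤ : (starGraph r).Subgraph).induce s).coe.Connected :=
    .of_isUniversal (v := (⟨c, hc⟩ : s)) fun x hx ↦
      ⟨hc, x.2, hadj x x.2 fun h ↦ hx (Subtype.ext h)⟩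
  exact ⟨hconn, (isAcyclic_starGraph r).subgraph _⟩

/-- The subtree representation on a star given by the fibers of a map `p` on the nodes. -/
def SubtreeRepresentation.ofFibers {V W α : Type*} (r : W) (p : W → α) (f : V → α)
    (hf : ∀ v, r ∈ p ⁻¹' {f v} ∨ ∃ c, p ⁻¹' {f v} = {c}) :
    SubtreeRepresentation
      (subgraphIntersectionGraph fun v ↦
        (⊤ : (SimpleGraph.starGraph r).Subgraph).induce (p ⁻¹' {f v}))
      (SimpleGraph.starGraph r) where
  isTree := SimpleGraph.isTree_starGraph r
  subtree v := (⊤ : (SimpleGraph.starGraph r).Subgraph).induce (p ⁻¹' {f v})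
  isTree_subtree v := SimpleGraph.isTree_coe_induce_starGraph (hf v)
  intersectionGraph_eq := rfl

/-- There is a `k ≤ n` such that the number of edges of a clique on `k` vertices is at least `n`,
but not by much. -/
theorem exists_clique_size {n : ℕ} (hn : 3 ≤ n) :
    ∃ k ≤ n, 2 * n ≤ k * (k - 1) ∧ k * (k - 1) ≤ 4 * n := by
  have hex : ∃ k, 2 * n ≤ k * (k - 1) :=
    ⟨n, by rw [mul_comm]; exact Nat.mul_le_mul_left n (by omega)⟩
  classical
  have hle : Nat.find hex ≤ n :=
    Nat.find_min' hex (by rw [mul_comm]; exact Nat.mul_le_mul_left n (by omega))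
  refine ⟨Nat.find hex, hle, Nat.find_spec hex, ?_⟩
  rcases hk : Nat.find hex with _ | k
  · simp
  · have h := Nat.find_min hex (m := k) (by omega)
    rw [hk] at hle
    rcases k with _ | k
    · simp
    · simp only [Nat.add_sub_cancel] at h ⊢
      -- Minimality gives `(k + 1) * k < 2 * n`; the next product exceeds this one by `2 * (k + 1) ≤
      -- 2 * n`.
      nlinarith

/-- A representation on a star with `n` nodes of a graph with `n` vertices and between
`n` and `5 * n / 2` edges, consisting of a large clique of large subtrees and of pairs of equal
single nodes. -/
theorem exists_large_representation {n : ℕ} (hn : 3 ≤ n) :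
    ∃ (G : SimpleGraph (Fin n)) (T : SimpleGraph (Fin n)) (R : SubtreeRepresentation G T) (k : ℕ),
      G.IsChordalGraph ∧ n ≤ G.edgeSet.ncard ∧ 2 * G.edgeSet.ncard ≤ 5 * n ∧
      2 * n ≤ k * (k - 1) ∧ k * n ≤ 3 * R.size := by
  classical
  obtain ⟨k, hkn, hk₁, hk₂⟩ := exists_clique_size hn
  -- Nodes `j ≥ n / 2` are merged into the fiber of the center `r`, the other fibers being single
  -- leaves. The label `i / 2 < n / 2` always names such a leaf, used by at most two indices.
  set r : Fin n := ⟨n - 1, by omega⟩ with hr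
  set p : Fin n → Fin n := fun j ↦ if n ≤ 2 * (j : ℕ) then r else j with hp
  set f : Fin n → Fin n := fun i ↦ if (i : ℕ) < k then r else ⟨i / 2, by omega⟩ with hf
  have hpr : p r = r := by simp [hp]
  have hpf : ∀ i, p (f i) = f i := by
    intro i
    by_cases hi : (i : ℕ) < k
    · simp [hf, hi, hpr]
    · have : ¬ n ≤ 2 * ((i : ℕ) / 2) := by omega
      simp [hf, hi, hp, this]
  have hfib : ∀ v, r ∈ p ⁻¹' {f v} ∨ ∃ c, p ⁻¹' {f v} = {c} := by
    intro v
    by_cases hv : f v = r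
    · left
      simp [hv, hpr]
    · right
      refine ⟨f v, Set.ext fun j ↦ ⟨fun hj ↦ ?_, ?_⟩⟩
      · simp only [Set.mem_preimage, Set.mem_singleton_iff, hp] at hj
        split_ifs at hj with h
        · exact (hv hj.symm).elim
        · exact hj
      · rintro rfl
        exact hpf v
  obtain ⟨G, R, hverts⟩ : ∃ (G : SimpleGraph (Fin n))
      (R : SubtreeRepresentation G (SimpleGraph.starGraph r)),
      ∀ v, (R.subtree v).verts = p ⁻¹' {f v} :=
    ⟨_, SubtreeRepresentation.ofFibers r p f hfib, fun _ ↦ rfl⟩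
  have hG : ∀ u v, G.Adj u v ↔ u ≠ v ∧ f u = f v := by
    intro u v
    rw [← R.intersectionGraph_eq]
    refine and_congr_right fun _ ↦ ?_
    rw [hverts, hverts]
    refine ⟨?_, fun h ↦ ⟨f u, hpf u, (hpf u).trans h⟩⟩
    rintro ⟨w, hu, hv⟩
    exact (show p w = f u from hu).symm.trans hv
  have hlt : ∀ a ≤ n, #{i : Fin n | (i : ℕ) < a} = a := by
    intro a ha
    simp [Fin.card_filter_val_lt, ha]
  have hdeg₁ : ∀ v : Fin n, (v : ℕ) < k → G.degree v = k - 1 := by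
    intro v hv
    rw [← G.card_neighborFinset_eq_degree]
    have : G.neighborFinset v = ({i : Fin n | (i : ℕ) < k} : Finset (Fin n)).erase v := by
      ext u
      rw [SimpleGraph.mem_neighborFinset, hG]
      simp only [mem_erase, mem_filter, mem_univ, true_and, hf, if_pos hv, ne_comm (a := v)]
      refine and_congr_right fun _ ↦ ?_
      split_ifs with hu
      · simp [hu]
      · simp only [hu, iff_false, hr, Fin.mk.injEq]
        omega
    rw [this, card_erase_of_mem (by simpa using hv), hlt k hkn]
  have hdeg₂ : ∀ v : Fin n, ¬ (v : ℕ) < k → G.degree v ≤ 1 := by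
    intro v hv
    rw [← G.card_neighborFinset_eq_degree, card_le_one]
    have key : ∀ u, G.Adj v u → (u : ℕ) ≠ v ∧ (u : ℕ) / 2 = v / 2 := by
      intro u hu
      rw [hG] at hu
      refine ⟨fun h ↦ hu.1 (Fin.ext h.symm), ?_⟩
      have h := hu.2
      simp only [hf, if_neg hv] at h
      split_ifs at h
      · simp only [hr, Fin.mk.injEq] at h
        omega
      · simp only [Fin.mk.injEq] at h
        exact h.symm
    intro a ha b hb
    rw [SimpleGraph.mem_neighborFinset] at ha hb
    have := key a ha
    have := key b hb
    exact Fin.ext (by omega)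
  have hsum := G.sum_degrees_eq_twice_ncard_edgeSet
  have hclique : ∑ v ∈ ({i : Fin n | (i : ℕ) < k} : Finset (Fin n)), G.degree v = k * (k - 1) := by
    rw [sum_congr rfl fun v hv ↦ hdeg₁ v (by simpa using hv), sum_const, hlt k hkn, smul_eq_mul]
  have hrest : ∑ v ∈ ({i : Fin n | ¬ (i : ℕ) < k} : Finset (Fin n)), G.degree v ≤ n := by
    refine (sum_le_card_nsmul _ _ 1 fun v hv ↦ hdeg₂ v (by simpa using hv)).trans ?_
    rw [smul_eq_mul, mul_one]
    exact (card_le_univ _).trans_eq (Fintype.card_fin n)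
  -- Now `2 * m` is `k * (k - 1)`, between `2 * n` and `4 * n`, plus at most `n`.
  rw [← sum_filter_add_sum_filter_not univ (fun i : Fin n ↦ (i : ℕ) < k), hclique] at hsum
  refine ⟨G, _, R, k, SimpleGraph.isChordalGraph_of_adj_iff f hG, by omega, by omega, hk₁, ?_⟩
  have hbig : ∀ v : Fin n, (v : ℕ) < k → n ≤ 3 * (R.subtree v).verts.ncard := by
    intro v hv
    -- These are `⌊n / 2⌋` nodes, at least `n / 3` since `n ≥ 2`.
    have hsub : (({j : Fin n | ¬ (j : ℕ) < (n + 1) / 2} : Finset (Fin n)) : Set (Fin n)) ⊆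
        (R.subtree v).verts := by
      intro j hj
      simp only [coe_filter, mem_univ, true_and, Set.mem_ofPred_eq] at hj
      have : n ≤ 2 * (j : ℕ) := by omega
      rw [hverts]
      simp [hp, hf, this, hv]
    have hcard := Set.ncard_le_ncard hsub
    rw [Set.ncard_coe_finset] at hcard
    have h := card_filter_add_card_filter_not (s := (univ : Finset (Fin n)))
      (fun j ↦ (j : ℕ) < (n + 1) / 2)
    rw [hlt _ (by omega), card_univ, Fintype.card_fin] at h
    omega
  calc k * n = ∑ v ∈ ({i : Fin n | (i : ℕ) < k} : Finset (Fin n)), n := by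
        rw [sum_const, hlt k hkn, smul_eq_mul]
    _ ≤ ∑ v ∈ ({i : Fin n | (i : ℕ) < k} : Finset (Fin n)), 3 * (R.subtree v).verts.ncard :=
      sum_le_sum fun v hv ↦ hbig v (by simpa using hv)
    _ ≤ ∑ v, 3 * (R.subtree v).verts.ncard := sum_le_sum_of_subset (subset_univ _)
    _ = 3 * R.size := by rw [SubtreeRepresentation.size, mul_sum]

theorem mainTheorem1 :
    (∀ (n m : ℕ) (V W : Type*) [Fintype V] [Fintype W] (G : SimpleGraph V) (T : SimpleGraph W)
        (R : SubtreeRepresentation G T),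
        Fintype.card V = n → Fintype.card W = n → G.edgeSet.ncard = m →
        (R.size : ℝ) ≤ 8 / 3 * √(2 * (n : ℝ) / 3) * (2 * (m : ℝ) + (n : ℝ))) ∧
    (∃ C : ℝ, 0 < C ∧
      ∀ (n m : ℕ) (V W : Type*) [Fintype V] [Fintype W] (G : SimpleGraph V) (T : SimpleGraph W)
        (R : SubtreeRepresentation G T),
        Fintype.card V = n → Fintype.card W = n → G.edgeSet.ncard = m →
        (R.size : ℝ) ≤ C * ((m : ℝ) * √(n : ℝ)) + (n : ℝ)) ∧
    (∃ c : ℝ, 0 < c ∧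
      ∀ n : ℕ, 3 ≤ n →
        ∃ (G : SimpleGraph (Fin n)) (T : SimpleGraph (Fin n)) (R : SubtreeRepresentation G T)
          (m : ℕ),
          G.IsChordalGraph ∧ G.edgeSet.ncard = m ∧ n ≤ m ∧
          c * ((2 * (m : ℝ) + (n : ℝ)) * √(n : ℝ)) ≤ (R.size : ℝ)) := by

  -- The constant 1/18 combines `2 * m + n ≤ 6 * n` with `√n * n ≤ k * n ≤ 3 * R.size`.
  refine ⟨?_, ⟨2, two_pos, ?_⟩, 1 / 18, by norm_num, ?_⟩
  · rintro n m V W _ _ G T R rfl hW rfl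
    have h := R.size_le hW
    have : Nonempty W := R.isTree.connected.nonempty
    have hpos : (1 : ℝ) ≤ Fintype.card V := by
      rw [← hW]
      exact_mod_cast Fintype.card_pos
    have hroot : 1 ≤ √(Fintype.card V : ℝ) := Real.one_le_sqrt.2 hpos
    -- Squaring reduces this to `1 ≤ 128 / 27`.
    have hle : √(Fintype.card V : ℝ) ≤ 8 / 3 * √(2 * (Fintype.card V : ℝ) / 3) := by
      refine Real.sqrt_le_iff.2 ⟨by positivity, ?_⟩
      rw [mul_pow, Real.sq_sqrt (by positivity)]
      linarith
    have hsq := Real.mul_self_sqrt (Nat.cast_nonneg (α := ℝ) (Fintype.card V))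
    have hmono := mul_le_mul_of_nonneg_right hle
      (by positivity : 0 ≤ 2 * (G.edgeSet.ncard : ℝ) + Fintype.card V)
    have := mul_le_mul_of_nonneg_right hroot (Nat.cast_nonneg (α := ℝ) (Fintype.card V))
    linarith
  · rintro n m V W _ _ G T R rfl hW rfl
    exact R.size_le hW
  · intro n hn
    obtain ⟨G, T, R, k, hG, hm₁, hm₂, hk, hsize⟩ := exists_large_representation hn
    refine ⟨G, T, R, _, hG, rfl, hm₁, ?_⟩
    have hroot : √(n : ℝ) ≤ k := by
      refine Real.sqrt_le_iff.2 ⟨Nat.cast_nonneg k, ?_⟩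
      have : k * (k - 1) ≤ k ^ 2 := by
        rw [sq]
        exact Nat.mul_le_mul_left k (Nat.sub_le k 1)
      exact_mod_cast (show n ≤ k ^ 2 by omega)
    have hm : 2 * (G.edgeSet.ncard : ℝ) + n ≤ 6 * n := by
      have : 2 * (G.edgeSet.ncard : ℝ) ≤ 5 * n := by exact_mod_cast hm₂
      linarith
    have hs : (k : ℝ) * n ≤ 3 * R.size := by exact_mod_cast hsize
    have := mul_le_mul hm hroot (Real.sqrt_nonneg _) (by positivity)
    linarith
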